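/- Let $(X,d)$ be a nonempty compact metric space. Let $\operatorname{Prob}(X)$ be the set of all Borel probability measures on $X$, with the Kantorovich metric $\widehat d(\mu,\nu)=\sup\{|\int_X f\,d\mu-\int_X f\,d\nu| : f\colon X\to\mathbb R \text{ nonexpansive}\}$ and its usual convex combinations. For a convex set $K\subseteq\operatorname{Prob}(X)$ let $\operatorname{Fix}(K)$ be the set of all points of $K$ that are fixed by every affine isometry of $K$ onto $K$; put $\operatorname{Fix}^0(K)=K$, $\operatorname{Fix}^{n}(K)=\operatorname{Fix}(\operatorname{Fix}^{n-1}(K))$ for $n>0$, and $\Delta(X)=\bigcap_{n\ge 0}\operatorname{Fix}^n(\operatorname{Prob}(X))$. For a compact metric space $(Y,d_Y)$ let $Y^{(1)}$ be the set of orbits of $Y$ under the group of all isometries of $Y$ onto $Y$, with the greatest pseudometric for which the canonical projection $Y\to Y^{(1)}$ is nonexpansive; this is a metric, and $Y^{(1)}$ is compact. Put $X^{(0)}=X$ and $X^{(n)}=(X^{(n-1)})^{(1)}$ for $n>0$. The space $X$ is called quasi-nilpotent if the diameters $\delta(X^{(n)})$ tend to $0$ as $n\to\infty$. Then $\Delta(X)$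 consists of a single measure if and only if $X$ is quasi-nilpotent. -/

import Mathlib

open MeasureTheory Filter Topology unitInterval

universe u

namespace CentralMeasure

/-! ### The orbit space of a compact metric space -/

section OrbitSpace

variable (X : Type u) [MetricSpace X]

/-- `x ∼ y` iff some isometry of `X` onto `X` carries `x` to `y`. -/
def isoSetoid : Setoid X where
  r x y := ∃ Φ : X ≃ᵢ X, Φ x = y
  iseqv :=
    { refl := fun x => ⟨IsometryEquiv.refl X, rfl⟩
      symm := by
        rintro x y ⟨Φ, rfl⟩
        exact ⟨Φ.symm, Φ.symm_apply_apply x⟩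
      trans := by
        rintro x y z ⟨Φ, rfl⟩ ⟨Ψ, rfl⟩
        exact ⟨Φ.trans Ψ, rfl⟩ }

/-- The set `X⁽¹⁾` of orbits of the isometry group of `X`. -/
def OrbitSpace : Type u := Quotient (isoSetoid X)

variable {X}

/-- The canonical projection `X → X⁽¹⁾`. -/
def proj (x : X) : OrbitSpace X := Quotient.mk (isoSetoid X) x

theorem proj_surjective : Function.Surjective (proj : X → OrbitSpace X) :=
  fun a => Quotient.exists_rep a

theorem proj_eq_iff {x y : X} : proj x = proj y ↔ ∃ Φ : X ≃ᵢ X, Φ x = y :=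
  Quotient.eq (r := isoSetoid X)

/-- `ρ` is a pseudometric on `X⁽¹⁾` for which the canonical projection is nonexpansive. -/
structure IsNonexpansivePseudometric (ρ : OrbitSpace X → OrbitSpace X → ℝ) : Prop where
  self_eq_zero : ∀ a, ρ a a = 0
  comm : ∀ a b, ρ a b = ρ b a
  triangle : ∀ a b c, ρ a c ≤ ρ a b + ρ b c
  nonexpansive : ∀ x y : X, ρ (proj x) (proj y) ≤ dist x y

variable (X) in
/-- The metric `d⁽¹⁾`: the greatest pseudometric on `X⁽¹⁾` for which the canonical projection is
nonexpansive (see `isNonexpansivePseudometric_orbitDist` and `le_orbitDist`). -/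
noncomputable def orbitDist (a b : OrbitSpace X) : ℝ :=
  sSup {r : ℝ | ∃ ρ : OrbitSpace X → OrbitSpace X → ℝ, IsNonexpansivePseudometric ρ ∧ r = ρ a b}

theorem bddAbove_orbitDist (a b : OrbitSpace X) :
    BddAbove {r : ℝ | ∃ ρ : OrbitSpace X → OrbitSpace X → ℝ,
      IsNonexpansivePseudometric ρ ∧ r = ρ a b} := by
  obtain ⟨x, rfl⟩ := proj_surjective a
  obtain ⟨y, rfl⟩ := proj_surjective b
  refine ⟨dist x y, ?_⟩
  rintro r ⟨ρ, hρ, rfl⟩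
  exact hρ.nonexpansive x y

theorem le_orbitDist {ρ : OrbitSpace X → OrbitSpace X → ℝ} (hρ : IsNonexpansivePseudometric ρ)
    (a b : OrbitSpace X) : ρ a b ≤ orbitDist X a b :=
  le_csSup (bddAbove_orbitDist a b) ⟨ρ, hρ, rfl⟩

theorem isNonexpansivePseudometric_zero :
    IsNonexpansivePseudometric (fun _ _ : OrbitSpace X => (0 : ℝ)) :=
  ⟨fun _ => rfl, fun _ _ => rfl, fun _ _ _ => by simp, fun _ _ => dist_nonneg⟩

theorem orbitDist_le {a b : OrbitSpace X} {C : ℝ}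
    (h : ∀ ρ : OrbitSpace X → OrbitSpace X → ℝ, IsNonexpansivePseudometric ρ → ρ a b ≤ C) :
    orbitDist X a b ≤ C := by
  refine csSup_le ⟨0, _, isNonexpansivePseudometric_zero, rfl⟩ ?_
  rintro r ⟨ρ, hρ, rfl⟩
  exact h ρ hρ

theorem isNonexpansivePseudometric_orbitDist : IsNonexpansivePseudometric (orbitDist X) where
  self_eq_zero a :=
    le_antisymm (orbitDist_le fun _ hρ => (hρ.self_eq_zero a).le)
      (le_orbitDist isNonexpansivePseudometric_zero a a)
  comm a b :=
    le_antisymm (orbitDist_le fun _ hρ => (hρ.comm a b).trans_le (le_orbitDist hρ b a))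
      (orbitDist_le fun _ hρ => (hρ.comm b a).trans_le (le_orbitDist hρ a b))
  triangle a b c := orbitDist_le fun _ hρ =>
    (hρ.triangle a b c).trans (add_le_add (le_orbitDist hρ a b) (le_orbitDist hρ b c))
  nonexpansive x y := orbitDist_le fun _ hρ => hρ.nonexpansive x y

/-- The distance between two orbits, as subsets of `X`. -/
noncomputable def fiberDist (a b : OrbitSpace X) : ℝ :=
  sInf {r : ℝ | ∃ x y : X, proj x = a ∧ proj y = b ∧ r = dist x y}

theorem bddBelow_fiberDist (a b : OrbitSpace X) :
    BddBelow {r : ℝ | ∃ x y : X, proj x = a ∧ proj y = b ∧ r = dist x y} := by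
  refine ⟨0, ?_⟩
  rintro r ⟨x, y, -, -, rfl⟩
  exact dist_nonneg

theorem fiberDist_nonempty (a b : OrbitSpace X) :
    {r : ℝ | ∃ x y : X, proj x = a ∧ proj y = b ∧ r = dist x y}.Nonempty := by
  obtain ⟨x, rfl⟩ := proj_surjective a
  obtain ⟨y, rfl⟩ := proj_surjective b
  exact ⟨_, x, y, rfl, rfl, rfl⟩

theorem fiberDist_nonneg (a b : OrbitSpace X) : 0 ≤ fiberDist a b := by
  refine le_csInf (fiberDist_nonempty a b) ?_
  rintro r ⟨x, y, -, -, rfl⟩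
  exact dist_nonneg

theorem fiberDist_le (x y : X) : fiberDist (proj x) (proj y) ≤ dist x y :=
  csInf_le (bddBelow_fiberDist _ _) ⟨x, y, rfl, rfl, rfl⟩

theorem fiberDist_triangle (a b c : OrbitSpace X) :
    fiberDist a c ≤ fiberDist a b + fiberDist b c := by
  rw [← sub_le_iff_le_add']
  refine le_csInf (fiberDist_nonempty b c) ?_
  rintro r ⟨y', z, rfl, rfl, rfl⟩
  rw [sub_le_comm]
  refine le_csInf (fiberDist_nonempty _ _) ?_
  rintro r ⟨x, y, rfl, hy, rfl⟩
  obtain ⟨Φ, rfl⟩ := proj_eq_iff.1 hy.symm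
  have hz : proj (Φ z) = proj z := (proj_eq_iff.2 ⟨Φ, rfl⟩).symm
  have h := fiberDist_le x (Φ z)
  rw [hz] at h
  have h' := dist_triangle x (Φ y') (Φ z)
  rw [Φ.dist_eq] at h'
  linarith

theorem isNonexpansivePseudometric_fiberDist :
    IsNonexpansivePseudometric (fiberDist : OrbitSpace X → OrbitSpace X → ℝ) where
  self_eq_zero a := by
    obtain ⟨x, rfl⟩ := proj_surjective a
    exact le_antisymm ((fiberDist_le x x).trans_eq (dist_self x)) (fiberDist_nonneg _ _)
  comm a b := by
    unfold fiberDist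
    congr 1
    ext r
    constructor
    · rintro ⟨x, y, hx, hy, rfl⟩
      exact ⟨y, x, hy, hx, dist_comm x y⟩
    · rintro ⟨x, y, hx, hy, rfl⟩
      exact ⟨y, x, hy, hx, dist_comm x y⟩
  triangle := fiberDist_triangle
  nonexpansive := fiberDist_le

theorem isClosed_orbit [CompactSpace X] (x : X) :
    IsClosed (Set.range fun Φ : X ≃ᵢ X => Φ x) := by
  rw [← closure_subset_iff_isClosed]
  intro y hy
  have hne : (comap (fun Φ : X ≃ᵢ X => Φ x) (𝓝 y)).NeBot := by
    rw [comap_neBot_iff]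
    intro t ht
    obtain ⟨_, hz, ⟨Φ, rfl⟩⟩ := mem_closure_iff_nhds.1 hy t ht
    exact ⟨Φ, hz⟩
  let U : Ultrafilter (X ≃ᵢ X) := Ultrafilter.of (comap (fun Φ : X ≃ᵢ X => Φ x) (𝓝 y))
  have hU : Tendsto (fun Φ : X ≃ᵢ X => Φ x) U (𝓝 y) :=
    tendsto_comap.mono_left (Ultrafilter.of_le _)
  have hlim : ∀ F : (X ≃ᵢ X) → X, ∃ l, Tendsto F U (𝓝 l) := by
    intro F
    obtain ⟨l, -, hl⟩ := isCompact_univ.ultrafilter_le_nhds (U.map F) (by simp)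
    exact ⟨l, hl⟩
  choose f hf using fun z => hlim fun Φ => Φ z
  choose g hg using fun z => hlim fun Φ => Φ.symm z
  have hgf : ∀ z, g (f z) = z := by
    intro z
    have h1 : Tendsto (fun Φ : X ≃ᵢ X => dist (Φ.symm (f z)) z) U (𝓝 (dist (g (f z)) z)) :=
      (hg (f z)).dist tendsto_const_nhds
    have h2 : Tendsto (fun Φ : X ≃ᵢ X => dist (f z) (Φ z)) U (𝓝 (dist (f z) (f z))) :=
      tendsto_const_nhds.dist (hf z)
    have h3 : (fun Φ : X ≃ᵢ X => dist (Φ.symm (f z)) z) = fun Φ : X ≃ᵢ X => dist (f z) (Φ z) := by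
      funext Φ
      rw [← Φ.dist_eq, Φ.apply_symm_apply]
    rw [h3] at h1
    have h4 := tendsto_nhds_unique h1 h2
    rwa [dist_self, dist_eq_zero] at h4
  have hfg : ∀ z, f (g z) = z := by
    intro z
    have h1 : Tendsto (fun Φ : X ≃ᵢ X => dist (Φ (g z)) z) U (𝓝 (dist (f (g z)) z)) :=
      (hf (g z)).dist tendsto_const_nhds
    have h2 : Tendsto (fun Φ : X ≃ᵢ X => dist (g z) (Φ.symm z)) U (𝓝 (dist (g z) (g z))) :=
      tendsto_const_nhds.dist (hg z)
    have h3 : (fun Φ : X ≃ᵢ X => dist (Φ (g z)) z) =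
        fun Φ : X ≃ᵢ X => dist (g z) (Φ.symm z) := by
      funext Φ
      rw [← Φ.symm.dist_eq, Φ.symm_apply_apply]
    rw [h3] at h1
    have h4 := tendsto_nhds_unique h1 h2
    rwa [dist_self, dist_eq_zero] at h4
  have hiso : Isometry f := by
    refine Isometry.of_dist_eq fun z w => ?_
    have h1 : Tendsto (fun Φ : X ≃ᵢ X => dist (Φ z) (Φ w)) U (𝓝 (dist (f z) (f w))) :=
      (hf z).dist (hf w)
    simp only [IsometryEquiv.dist_eq] at h1
    exact tendsto_nhds_unique h1 tendsto_const_nhds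
  exact ⟨⟨⟨f, g, hgf, hfg⟩, hiso⟩, tendsto_nhds_unique (hf x) hU⟩

theorem eq_of_orbitDist_eq_zero [CompactSpace X] {a b : OrbitSpace X}
    (h : orbitDist X a b = 0) : a = b := by
  have h0 : fiberDist a b = 0 := le_antisymm
    (h ▸ le_orbitDist isNonexpansivePseudometric_fiberDist a b) (fiberDist_nonneg a b)
  obtain ⟨x, rfl⟩ := proj_surjective a
  obtain ⟨y, rfl⟩ := proj_surjective b
  have hx : x ∈ closure (Set.range fun Φ : X ≃ᵢ X => Φ y) := by
    rw [Metric.mem_closure_iff]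
    intro ε hε
    obtain ⟨r, ⟨x', y', hx', hy', rfl⟩, hr⟩ :=
      exists_lt_of_csInf_lt (fiberDist_nonempty (proj x) (proj y)) (h0.trans_lt hε)
    obtain ⟨Φ, rfl⟩ := proj_eq_iff.1 hx'
    obtain ⟨Ψ, rfl⟩ := proj_eq_iff.1 hy'.symm
    refine ⟨Φ (Ψ y), ⟨Ψ.trans Φ, rfl⟩, ?_⟩
    rwa [Φ.dist_eq]
  rw [(isClosed_orbit y).closure_eq] at hx
  obtain ⟨Φ, hΦ⟩ := hx
  exact (proj_eq_iff.2 ⟨Φ, hΦ⟩).symm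

/-- `X⁽¹⁾` is a metric space under `d⁽¹⁾` when `X` is compact. -/
noncomputable instance [CompactSpace X] : MetricSpace (OrbitSpace X) where
  dist := orbitDist X
  dist_self := isNonexpansivePseudometric_orbitDist.self_eq_zero
  dist_comm := isNonexpansivePseudometric_orbitDist.comm
  dist_triangle := isNonexpansivePseudometric_orbitDist.triangle
  eq_of_dist_eq_zero := eq_of_orbitDist_eq_zero

theorem lipschitzWith_proj [CompactSpace X] : LipschitzWith 1 (proj : X → OrbitSpace X) :=
  LipschitzWith.of_dist_le_mul fun x y => by
    rw [NNReal.coe_one, one_mul]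
    exact isNonexpansivePseudometric_orbitDist.nonexpansive x y

instance [CompactSpace X] : CompactSpace (OrbitSpace X) := by
  rw [← isCompact_univ_iff, ← (proj_surjective (X := X)).range_eq]
  exact isCompact_range lipschitzWith_proj.continuous

end OrbitSpace

/-! ### The iterated orbit spaces and quasi-nilpotency -/

/-- A compact metric space, bundled so that the construction `X ↦ X⁽¹⁾` can be iterated. -/
structure CompactMetric : Type (u + 1) where
  carrier : Type u
  [metric : MetricSpace carrier]
  [compact : CompactSpace carrier]

attribute [instance] CompactMetric.metric CompactMetric.compact

/-- The iterated orbit spaces: `X⁽⁰⁾ = X` and `X⁽ⁿ⁺¹⁾ = (X⁽ⁿ⁾)⁽¹⁾`. -/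
noncomputable def iterOrbitSpace (X : Type u) [MetricSpace X] [CompactSpace X] :
    ℕ → CompactMetric.{u}
  | 0 => ⟨X⟩
  | n + 1 => ⟨OrbitSpace (iterOrbitSpace X n).carrier⟩

/-- `X` is quasi-nilpotent iff the diameters of the spaces `X⁽ⁿ⁾` tend to `0`. -/
def QuasiNilpotent (X : Type u) [MetricSpace X] [CompactSpace X] : Prop :=
  Tendsto (fun n : ℕ => Metric.diam (Set.univ : Set (iterOrbitSpace X n).carrier)) atTop (𝓝 0)

/-! ### Probability measures and fixed points of affine isometries -/

section Prob

variable {X : Type u} [MetricSpace X] [MeasurableSpace X]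

/-- The Kantorovich distance of two Borel probability measures:
the supremum of `|∫ f dμ - ∫ f dν|` over all nonexpansive `f : X → ℝ`.
If `X` is compact, the integrals exist and the supremum is at most the diameter of `X`. -/
noncomputable def kantorovichDist (μ ν : ProbabilityMeasure X) : ℝ :=
  sSup {r : ℝ | ∃ f : X → ℝ, LipschitzWith 1 f ∧
    r = |(∫ x, f x ∂(μ : Measure X)) - ∫ x, f x ∂(ν : Measure X)|}

/-- The convex combination `t μ + (1 - t) ν`. -/
noncomputable def convexComb (t : I) (μ ν : ProbabilityMeasure X) : ProbabilityMeasure X :=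
  ⟨toNNReal t • (μ : Measure X) + toNNReal (σ t) • (ν : Measure X), inferInstance⟩

/-- `T` is an affine isometry of the set `K` of probability measures onto itself, with respect to
the Kantorovich distance. -/
structure IsAffineIsometry (K : Set (ProbabilityMeasure X)) (T : K ≃ K) : Prop where
  isometry : ∀ μ ν : K, kantorovichDist (T μ : ProbabilityMeasure X) (T ν) = kantorovichDist μ.1 ν.1
  affine : ∀ (t : I) (μ ν ρ : K), (ρ : ProbabilityMeasure X) = convexComb t μ ν →
    (T ρ : ProbabilityMeasure X) = convexComb t (T μ) (T ν)

/-- `Fix(K)`: the points of `K` fixed by every affine isometry of `K` onto `K`. -/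
def fixSet (K : Set (ProbabilityMeasure X)) : Set (ProbabilityMeasure X) :=
  {μ | ∃ h : μ ∈ K, ∀ T : K ≃ K, IsAffineIsometry K T → (T ⟨μ, h⟩ : ProbabilityMeasure X) = μ}

/-- `Fix⁰(K) = K` and `Fixⁿ⁺¹(K) = Fix(Fixⁿ(K))`. -/
def iterFix (K : Set (ProbabilityMeasure X)) : ℕ → Set (ProbabilityMeasure X)
  | 0 => K
  | n + 1 => fixSet (iterFix K n)

variable (X) in
/-- `Δ(X) = Fix^∞(Prob(X))`, the intersection of all `Fixⁿ(Prob(X))`. -/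
def centralSet : Set (ProbabilityMeasure X) :=
  ⋂ n : ℕ, iterFix (Set.univ : Set (ProbabilityMeasure X)) n

end Prob

end CentralMeasure

universe v

namespace CentralMeasure

/-! ### The Kantorovich distance -/

section Kantorovich

variable {X : Type u} [MetricSpace X]

/-! The sets `Fixⁿ(Prob X)` are affinely isometric copies of `Prob(X⁽ⁿ⁾)`, so their Kantorovich
diameters are those of `X⁽ⁿ⁾`.

For `n = 1` this has two halves. An affine isometry of `Prob X` permutes the extreme points. These
are the Dirac measures, which form an isometric copy of `X`, and their convex combinations are
dense; so the map is the push-forward along an isometry of `X` (`exists_eq_pushforwardIso`), and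
`Fix(Prob X)` consists of the measures invariant under the isometry group. That group is compact and
has a Haar probability measure. Averaging over it shows that pushing forward to the orbit space is
bijective on invariant measures (`bijOn_pushforward_proj`) and preserves the Kantorovich distance
(`kantorovichDist_pushforward_proj`). Since `Fix` depends only on the affine metric structure
(`bijOn_fixSet`), induction gives all `n` (`exists_bijOn_iterFix`).

The `Fixⁿ(Prob X)` decrease, are nonempty and are closed in a compact space. Hence their
intersection is nonempty, and it is a single point exactly when the diameters tend to zero;
`exists_mem_centralSet_tendsto` supplies the compactness. -/

theorem dist_le_diam_univ [CompactSpace X] (x y : X) : dist x y ≤ Metric.diam (Set.univ : Set X) :=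
  Metric.dist_le_diam_of_mem isCompact_univ.isBounded trivial trivial

/-- Arzelà–Ascoli. Normalizing at `x₀` costs nothing, since constants cancel in a difference of
integrals against probability measures. -/
theorem totallyBounded_lipschitz_vanishing_at [CompactSpace X] (x₀ : X) :
    TotallyBounded {f : BoundedContinuousFunction X ℝ | LipschitzWith 1 f ∧ f x₀ = 0} := by
  refine (BoundedContinuousFunction.arzela_ascoli
    (Metric.closedBall (0 : ℝ) (Metric.diam (Set.univ : Set X))) (isCompact_closedBall _ _) _
    ?_ ?_).totallyBounded.subset subset_closure
  · rintro f x ⟨hf, h0⟩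
    have h1 := hf.dist_le_mul x x₀
    rw [h0, NNReal.coe_one, one_mul] at h1
    exact h1.trans (dist_le_diam_univ x x₀)
  · exact (LipschitzWith.uniformEquicontinuous _ 1 fun f => f.2.1).equicontinuous

variable [MeasurableSpace X]

theorem eq_of_forall_integral_lipschitz_eq [BorelSpace X] {μ ν : ProbabilityMeasure X}
    (h : ∀ f : X → ℝ, LipschitzWith 1 f →
      (∫ x, f x ∂(μ : Measure X)) = ∫ x, f x ∂(ν : Measure X)) : μ = ν := by
  have h1 : Tendsto (fun _ : ℕ => μ) atTop (𝓝 ν) := by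
    rw [tendsto_iff_forall_lipschitz_integral_tendsto]
    rintro f - ⟨L, hL⟩
    -- Dividing by `L + 1` rather than `L` also covers `L = 0`.
    have h2 : LipschitzWith 1 fun x => ((L : ℝ) + 1)⁻¹ * f x := by
      refine LipschitzWith.of_dist_le_mul fun x y => ?_
      have h3 := hL.dist_le_mul x y
      have h4 : (0 : ℝ) < (L : ℝ) + 1 := by positivity
      rw [Real.dist_eq, ← mul_sub, abs_mul, abs_of_pos (inv_pos.2 h4), ← Real.dist_eq,
        NNReal.coe_one, one_mul, inv_mul_le_iff₀ h4]
      nlinarith [dist_nonneg (x := x) (y := y)]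
    have h5 := h _ h2
    rw [integral_const_mul, integral_const_mul] at h5
    rw [mul_left_cancel₀ (by positivity) h5]
    exact tendsto_const_nhds
  exact tendsto_nhds_unique tendsto_const_nhds h1

theorem kantorovichDist_le {μ ν : ProbabilityMeasure X} {C : ℝ}
    (h : ∀ f : X → ℝ, LipschitzWith 1 f →
      |(∫ x, f x ∂(μ : Measure X)) - ∫ x, f x ∂(ν : Measure X)| ≤ C) :
    kantorovichDist μ ν ≤ C := by
  refine csSup_le ⟨_, fun _ => 0, LipschitzWith.const' 0, rfl⟩ ?_
  rintro r ⟨f, hf, rfl⟩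
  exact h f hf

theorem kantorovichDist_comm (μ ν : ProbabilityMeasure X) :
    kantorovichDist μ ν = kantorovichDist ν μ := by
  simp only [kantorovichDist, abs_sub_comm]

variable [CompactSpace X] [BorelSpace X]

theorem integrable_of_continuous {f : X → ℝ} (hf : Continuous f) (μ : Measure X)
    [IsFiniteMeasure μ] : Integrable f μ :=
  hf.integrable_of_hasCompactSupport (HasCompactSupport.of_compactSpace f)

/-- Every value of `f` lies within the diameter of its `ν`-average. This bounds the set of which
`kantorovichDist` is the supremum, so that `sSup` does not take its default value. -/
theorem abs_integral_sub_le_diam {f : X → ℝ} (hf : LipschitzWith 1 f)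
    (μ ν : ProbabilityMeasure X) :
    |(∫ x, f x ∂(μ : Measure X)) - ∫ x, f x ∂(ν : Measure X)| ≤
      Metric.diam (Set.univ : Set X) := by
  have hμ := integrable_of_continuous hf.continuous (μ : Measure X)
  have hν := integrable_of_continuous hf.continuous (ν : Measure X)
  have h1 : ∀ x, |f x - ∫ y, f y ∂(ν : Measure X)| ≤ Metric.diam (Set.univ : Set X) := by
    intro x
    have h2 : f x - ∫ y, f y ∂(ν : Measure X) = ∫ y, (f x - f y) ∂(ν : Measure X) := by
      rw [integral_sub (integrable_const _) hν]
      simp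
    rw [h2, ← Real.norm_eq_abs]
    refine (norm_integral_le_of_norm_le_const (C := Metric.diam (Set.univ : Set X))
      (.of_forall fun y => ?_)).trans_eq (by simp)
    have h3 := hf.dist_le_mul x y
    rw [NNReal.coe_one, one_mul, dist_eq_norm] at h3
    exact h3.trans (dist_le_diam_univ x y)
  have h4 : (∫ x, f x ∂(μ : Measure X)) - ∫ x, f x ∂(ν : Measure X) =
      ∫ x, (f x - ∫ y, f y ∂(ν : Measure X)) ∂(μ : Measure X) := by
    rw [integral_sub hμ (integrable_const _)]
    simp
  rw [h4, ← Real.norm_eq_abs]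
  exact (norm_integral_le_of_norm_le_const (C := Metric.diam (Set.univ : Set X))
    (.of_forall h1)).trans_eq (by simp)

theorem abs_integral_sub_le_kantorovichDist {f : X → ℝ} (hf : LipschitzWith 1 f)
    (μ ν : ProbabilityMeasure X) :
    |(∫ x, f x ∂(μ : Measure X)) - ∫ x, f x ∂(ν : Measure X)| ≤ kantorovichDist μ ν := by
  refine le_csSup ⟨Metric.diam (Set.univ : Set X), ?_⟩ ⟨f, hf, rfl⟩
  rintro r ⟨g, hg, rfl⟩
  exact abs_integral_sub_le_diam hg μ ν

theorem kantorovichDist_le_diam (μ ν : ProbabilityMeasure X) :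
    kantorovichDist μ ν ≤ Metric.diam (Set.univ : Set X) :=
  kantorovichDist_le fun _ hf => abs_integral_sub_le_diam hf μ ν

theorem kantorovichDist_nonneg (μ ν : ProbabilityMeasure X) : 0 ≤ kantorovichDist μ ν :=
  (abs_nonneg _).trans (abs_integral_sub_le_kantorovichDist (LipschitzWith.const' 0) μ ν)

theorem kantorovichDist_triangle (μ ν ρ : ProbabilityMeasure X) :
    kantorovichDist μ ρ ≤ kantorovichDist μ ν + kantorovichDist ν ρ :=
  kantorovichDist_le fun _ hf => (abs_sub_le _ _ _).trans
    (add_le_add (abs_integral_sub_le_kantorovichDist hf μ ν)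
      (abs_integral_sub_le_kantorovichDist hf ν ρ))

theorem eq_of_kantorovichDist_le_zero {μ ν : ProbabilityMeasure X}
    (h : kantorovichDist μ ν ≤ 0) : μ = ν :=
  eq_of_forall_integral_lipschitz_eq fun _ hf => sub_eq_zero.1 <| abs_nonpos_iff.1 <|
    (abs_integral_sub_le_kantorovichDist hf μ ν).trans h

theorem integral_diracProba (f : X → ℝ) (x : X) :
    ∫ y, f y ∂(diracProba x : Measure X) = f x :=
  integral_dirac f x

theorem kantorovichDist_diracProba (x y : X) :
    kantorovichDist (diracProba x) (diracProba y) = dist x y := by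
  refine le_antisymm (kantorovichDist_le fun f hf => ?_) ?_
  · rw [integral_diracProba, integral_diracProba]
    simpa [Real.dist_eq] using hf.dist_le_mul x y
  · have h := abs_integral_sub_le_kantorovichDist (LipschitzWith.dist_left y)
      (diracProba x) (diracProba y)
    rwa [integral_diracProba, integral_diracProba, dist_self, sub_zero,
      abs_of_nonneg dist_nonneg] at h

/-- Weak convergence is uniform over nonexpansive test functions, because after normalization these
are totally bounded. -/
theorem tendsto_kantorovichDist {ι : Type*} {F : Filter ι} {μs : ι → ProbabilityMeasure X}
    {μ : ProbabilityMeasure X} (h : Tendsto μs F (𝓝 μ)) :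
    Tendsto (fun i => kantorovichDist (μs i) μ) F (𝓝 0) := by
  have x₀ : X := by
    have := (μ : Measure X).nonempty_of_neZero
    exact Classical.arbitrary X
  rw [ProbabilityMeasure.tendsto_iff_forall_integral_tendsto] at h
  rw [Metric.tendsto_nhds]
  intro ε hε
  -- Three errors of `ε / 4` add up: replacing `f₀` by a net point under `μs i`, convergence at that
  -- net point, and replacing it back under `μ`.
  obtain ⟨t, ht, hcover⟩ := Metric.totallyBounded_iff.1
    (totallyBounded_lipschitz_vanishing_at x₀) (ε / 4) (by positivity)
  have h1 : ∀ᶠ i in F, ∀ g ∈ t, dist (∫ x, g x ∂(μs i : Measure X))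
      (∫ x, g x ∂(μ : Measure X)) < ε / 4 :=
    ht.eventually_all.2 fun g _ => Metric.tendsto_nhds.1 (h g) _ (by positivity)
  filter_upwards [h1] with i hi
  rw [Real.dist_0_eq_abs, abs_of_nonneg (kantorovichDist_nonneg _ _)]
  refine (kantorovichDist_le (C := 3 * (ε / 4)) fun f hf => ?_).trans_lt (by linarith)
  let f₀ : BoundedContinuousFunction X ℝ :=
    BoundedContinuousFunction.mkOfCompact ⟨fun x => f x - f x₀, by
      have := hf.continuous
      fun_prop⟩
  have hf₀ : LipschitzWith 1 f₀ := by
    refine LipschitzWith.of_dist_le_mul fun x y => ?_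
    have := hf.dist_le_mul x y
    simpa [f₀, Real.dist_eq] using this
  obtain ⟨g, hg, hfg⟩ := Set.mem_iUnion₂.1 (hcover ⟨hf₀, by simp [f₀]⟩)
  have h2 : ∀ ρ : ProbabilityMeasure X,
      (∫ x, f₀ x ∂(ρ : Measure X)) = (∫ x, f x ∂(ρ : Measure X)) - f x₀ := by
    intro ρ
    change ∫ x, (f x - f x₀) ∂(ρ : Measure X) = _
    rw [integral_sub (integrable_of_continuous hf.continuous _) (integrable_const _)]
    simp
  have h3 : ∀ ρ : ProbabilityMeasure X,
      |(∫ x, f₀ x ∂(ρ : Measure X)) - ∫ x, g x ∂(ρ : Measure X)| ≤ ε / 4 := by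
    intro ρ
    rw [← integral_sub (integrable_of_continuous f₀.continuous _)
      (integrable_of_continuous g.continuous _), ← Real.norm_eq_abs]
    refine (norm_integral_le_of_norm_le_const (C := ε / 4) (.of_forall fun x => ?_)).trans_eq
      (by simp)
    rw [← dist_eq_norm]
    exact (BoundedContinuousFunction.dist_coe_le_dist x).trans (Metric.mem_ball.1 hfg).le
  have h4 := h3 (μs i)
  have h5 := h3 μ
  have h6 := hi g hg
  rw [h2] at h4 h5
  rw [Real.dist_eq] at h6
  rw [abs_le] at *
  rw [abs_lt] at h6
  constructor <;> linarith [h4.1, h4.2, h5.1, h5.2, h6.1, h6.2]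

/-- Sets of probability measures that are closed for the Kantorovich distance. -/
def KantorovichClosed (K : Set (ProbabilityMeasure X)) : Prop :=
  ∀ μ, (∀ ε > 0, ∃ ν ∈ K, kantorovichDist μ ν < ε) → μ ∈ K

end Kantorovich

/-! ### Push-forwards and convex combinations -/

section ConvexComb

variable {X : Type u} {Y : Type v} [MeasurableSpace X] [MeasurableSpace Y]

theorem toMeasure_convexComb (t : I) (μ ν : ProbabilityMeasure X) :
    (convexComb t μ ν : Measure X) =
      toNNReal t • (μ : Measure X) + toNNReal (σ t) • (ν : Measure X) := rfl

/-- A map between spaces of probability measures preserving convex combinations. -/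
def PreservesConvexComb (P : ProbabilityMeasure X → ProbabilityMeasure Y) : Prop :=
  ∀ t μ ν, P (convexComb t μ ν) = convexComb t (P μ) (P ν)

/-- A set of probability measures closed under convex combinations. -/
def ConvexCombClosed (K : Set (ProbabilityMeasure X)) : Prop :=
  ∀ t, ∀ μ ∈ K, ∀ ν ∈ K, convexComb t μ ν ∈ K

theorem PreservesConvexComb.symm {P : ProbabilityMeasure X ≃ ProbabilityMeasure Y}
    (hP : PreservesConvexComb P) : PreservesConvexComb P.symm := by
  intro t μ ν
  rw [Equiv.symm_apply_eq, hP, Equiv.apply_symm_apply, Equiv.apply_symm_apply]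

/-- The push-forward of a probability measure along a measurable map. -/
noncomputable def pushforward {f : X → Y} (hf : Measurable f) (μ : ProbabilityMeasure X) :
    ProbabilityMeasure Y :=
  μ.map hf.aemeasurable

theorem toMeasure_pushforward {f : X → Y} (hf : Measurable f) (μ : ProbabilityMeasure X) :
    (pushforward hf μ : Measure Y) = (μ : Measure X).map f := rfl

theorem preservesConvexComb_pushforward {f : X → Y} (hf : Measurable f) :
    PreservesConvexComb (pushforward hf) := by
  intro t μ ν
  apply ProbabilityMeasure.toMeasure_injective
  change ((convexComb t μ ν : Measure X)).map f = _
  rw [toMeasure_convexComb, Measure.map_add _ _ hf, Measure.map_smul, Measure.map_smul]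
  rfl

theorem pushforward_diracProba {f : X → Y} (hf : Measurable f) (x : X) :
    pushforward hf (diracProba x) = diracProba (f x) :=
  ProbabilityMeasure.toMeasure_injective (Measure.map_dirac' hf x)

theorem pushforward_pushforward {Z : Type*} [MeasurableSpace Z] {f : X → Y} {g : Y → Z}
    (hg : Measurable g) (hf : Measurable f) (μ : ProbabilityMeasure X) :
    pushforward hg (pushforward hf μ) = pushforward (hg.comp hf) μ :=
  ProbabilityMeasure.toMeasure_injective (Measure.map_map hg hf)

/-- A probability measure is a proper convex combination of its conditionings on a set and on the
complement of that set. -/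
theorem exists_convexComb_cond {A : Set X} (hA : MeasurableSet A) (μ : ProbabilityMeasure X)
    (h0 : (μ : Measure X) A ≠ 0) (h1 : (μ : Measure X) Aᶜ ≠ 0) :
    ∃ t : I, t ≠ 0 ∧ t ≠ 1 ∧ ∃ μ₁ μ₂ : ProbabilityMeasure X,
      (μ₁ : Measure X) = ProbabilityTheory.cond (μ : Measure X) A ∧
      (μ₂ : Measure X) = ProbabilityTheory.cond (μ : Measure X) Aᶜ ∧
      μ = convexComb t μ₁ μ₂ := by
  have hsum : (μ : Measure X) A + (μ : Measure X) Aᶜ = 1 := prob_add_prob_compl hA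
  let t : I := ⟨(μ : Measure X).real A, measureReal_nonneg, measureReal_le_one⟩
  have ht : ((toNNReal t : NNReal) : ENNReal) = (μ : Measure X) A :=
    ENNReal.coe_toNNReal (measure_ne_top _ _)
  have hst : ((toNNReal (σ t) : NNReal) : ENNReal) = (μ : Measure X) Aᶜ := by
    have h2 : ((toNNReal t : NNReal) : ENNReal) + (toNNReal (σ t) : NNReal) = 1 := by
      exact_mod_cast toNNReal_add_toNNReal_symm t
    rw [ht, ← hsum] at h2
    exact (ENNReal.add_right_inj (measure_ne_top _ _)).1 h2
  let μ₁ : ProbabilityMeasure X := ⟨_, ProbabilityTheory.cond_isProbabilityMeasure h0⟩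
  let μ₂ : ProbabilityMeasure X := ⟨_, ProbabilityTheory.cond_isProbabilityMeasure h1⟩
  refine ⟨t, ?_, ?_, μ₁, μ₂, rfl, rfl, ?_⟩
  · intro h
    rw [h] at ht
    exact h0 (by simpa using ht.symm)
  · intro h
    rw [h] at hst
    exact h1 (by simpa using hst.symm)
  · apply ProbabilityMeasure.toMeasure_injective
    rw [toMeasure_convexComb]
    refine Measure.ext fun s hs => ?_
    change (μ : Measure X) s =
      toNNReal t • (μ₁ : Measure X) s + toNNReal (σ t) • (μ₂ : Measure X) s
    rw [ENNReal.smul_def, ENNReal.smul_def, ht, hst, smul_eq_mul, smul_eq_mul, mul_comm,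
      mul_comm ((μ : Measure X) Aᶜ)]
    exact (ProbabilityTheory.cond_add_cond_compl_eq hA (μ : Measure X)).symm

/-- A probability measure that is not a proper convex combination of different measures. -/
def IsExtremeProb (μ : ProbabilityMeasure X) : Prop :=
  ∀ t : I, t ≠ 0 → t ≠ 1 → ∀ μ₁ μ₂, μ = convexComb t μ₁ μ₂ → μ₁ = μ₂

theorem IsExtremeProb.map {P : ProbabilityMeasure X ≃ ProbabilityMeasure Y}
    (hP : PreservesConvexComb P) {μ : ProbabilityMeasure X} (hμ : IsExtremeProb μ) :
    IsExtremeProb (P μ) := by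
  intro t h0 h1 μ₁ μ₂ h
  rw [← Equiv.eq_symm_apply, hP.symm] at h
  exact P.symm.injective (hμ t h0 h1 _ _ h)

theorem eq_diracProba [MeasurableSingletonClass X] {μ : ProbabilityMeasure X} {x : X}
    (h : (μ : Measure X) {x}ᶜ = 0) : μ = diracProba x := by
  refine ProbabilityMeasure.toMeasure_injective (Measure.ext fun s hs => ?_)
  change _ = Measure.dirac x s
  by_cases hx : x ∈ s
  · rw [Measure.dirac_apply_of_mem hx]
    exact (prob_compl_eq_zero_iff hs).1
      (measure_mono_null (by simpa using hx) h)
  · rw [Measure.dirac_apply' _ hs, Set.indicator_of_notMem hx]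
    exact measure_mono_null (by simpa using hx) h

theorem isExtremeProb_diracProba [MeasurableSingletonClass X] (x : X) :
    IsExtremeProb (diracProba x) := by
  intro t h0 h1 μ₁ μ₂ h
  have h2 : toNNReal t • (μ₁ : Measure X) {x}ᶜ + toNNReal (σ t) • (μ₂ : Measure X) {x}ᶜ = 0 := by
    change (convexComb t μ₁ μ₂ : Measure X) {x}ᶜ = 0
    rw [← h]
    simp
  have h3 : toNNReal t ≠ 0 := fun h => h0 (Subtype.ext (congrArg NNReal.toReal h))
  have h4 : toNNReal (σ t) ≠ 0 := fun h =>
    h1 (symm_eq_zero.1 (Subtype.ext (congrArg NNReal.toReal h)))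
  rw [add_eq_zero, smul_eq_zero_iff_right h3, smul_eq_zero_iff_right h4] at h2
  rw [eq_diracProba h2.1, eq_diracProba h2.2]

/-- If `0 < μ A < 1`, then `μ` is a proper mixture of its conditionings on `A` and `Aᶜ`, which
differ on `A`. So an extreme `μ` takes only the values 0 and 1, and in a standard Borel space such a
measure is a point mass. -/
theorem IsExtremeProb.exists_eq_diracProba [StandardBorelSpace X] {μ : ProbabilityMeasure X}
    (h : IsExtremeProb μ) : ∃ x, μ = diracProba x := by
  have : IsZeroOneMeasure (μ : Measure X) := by
    refine ⟨fun A hA => ?_⟩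
    by_contra! hne
    obtain ⟨h0, h1⟩ := hne
    have h2 : (μ : Measure X) Aᶜ ≠ 0 := fun h2 => h1 ((prob_compl_eq_zero_iff hA).1 h2)
    obtain ⟨t, ht0, ht1, μ₁, μ₂, hμ₁, hμ₂, hμ⟩ := exists_convexComb_cond hA μ h0 h2
    have h3 := congrArg (fun ρ : ProbabilityMeasure X => (ρ : Measure X) A)
      (h t ht0 ht1 μ₁ μ₂ hμ)
    simp only [hμ₁, hμ₂] at h3
    rw [ProbabilityTheory.cond_apply_self h0 (measure_ne_top _ _),
      ProbabilityTheory.cond_apply hA.compl] at h3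
    simp at h3
  obtain ⟨x, hx⟩ := IsZeroOneMeasure.exists_eq_dirac (μ := (μ : Measure X))
  exact ⟨x, ProbabilityMeasure.toMeasure_injective hx⟩

/-- Induction on the support: conditioning on `{a}` and on its complement splits off one atom. -/
theorem ConvexCombClosed.mem_of_finite_support [MeasurableSingletonClass X]
    {F : Set (ProbabilityMeasure X)} (hF : ConvexCombClosed F) (hdirac : ∀ x, diracProba x ∈ F)
    (s : Finset X) {μ : ProbabilityMeasure X} (h : (μ : Measure X) (s : Set X)ᶜ = 0) : μ ∈ F := by
  classical
  induction s using Finset.induction_on generalizing μ with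
  | empty => simp at h
  | insert a s _ ih =>
    by_cases h0 : (μ : Measure X) {a} = 0
    · refine ih (measure_mono_null (fun x hx => ?_) (measure_union_null h0 h))
      by_cases hxa : x = a
      · exact Or.inl hxa
      · right
        simpa [hxa] using hx
    by_cases h1 : (μ : Measure X) {a}ᶜ = 0
    · rw [eq_diracProba h1]
      exact hdirac a
    obtain ⟨t, -, -, μ₁, μ₂, hμ₁, hμ₂, hμ⟩ :=
      exists_convexComb_cond (measurableSet_singleton a) μ h0 h1
    rw [hμ]
    refine hF t _ ?_ _ (ih ?_)
    · rw [eq_diracProba (μ := μ₁) (x := a)]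
      · exact hdirac a
      · rw [hμ₁, ProbabilityTheory.cond_apply (measurableSet_singleton a)]
        simp
    · rw [hμ₂, ProbabilityTheory.cond_apply (measurableSet_singleton a).compl,
        ← Set.compl_union]
      rw [Finset.coe_insert, Set.insert_eq] at h
      rw [h, mul_zero]

end ConvexComb

/-! ### Affine isometries of the space of all probability measures -/

section AffineIsometry

variable {X : Type u} [MetricSpace X] [CompactSpace X]

theorem exists_simpleFunc_dist_lt [Nonempty X] [MeasurableSpace X] [BorelSpace X] {ε : ℝ}
    (hε : 0 < ε) : ∃ f : SimpleFunc X X, ∀ x, dist (f x) x < ε := by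
  have hcover : (Set.univ : Set X) ⊆ ⋃ k, Metric.ball (TopologicalSpace.denseSeq X k) ε := by
    intro x _
    obtain ⟨k, hk⟩ := (TopologicalSpace.denseRange_denseSeq X).exists_dist_lt x hε
    exact Set.mem_iUnion.2 ⟨_, hk⟩
  obtain ⟨t, ht⟩ := isCompact_univ.elim_finite_subcover _ (fun _ => Metric.isOpen_ball) hcover
  -- `t.sup id` is the largest index in the finite subcover, so the nearest point is chosen among at
  -- least all its centres.
  refine ⟨SimpleFunc.nearestPt (TopologicalSpace.denseSeq X) (t.sup id), fun x => ?_⟩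
  obtain ⟨k, hk, hx⟩ := Set.mem_iUnion₂.1 (ht (Set.mem_univ x))
  have h1 := SimpleFunc.edist_nearestPt_le (TopologicalSpace.denseSeq X) x
    (Finset.le_sup (f := id) hk)
  rw [edist_dist, edist_dist, ENNReal.ofReal_le_ofReal_iff dist_nonneg] at h1
  exact h1.trans_lt (by rw [dist_comm]; exact hx)

variable [MeasurableSpace X] [BorelSpace X]

theorem exists_finite_support_kantorovichDist_le (μ : ProbabilityMeasure X) {ε : ℝ} (hε : 0 < ε) :
    ∃ (s : Finset X) (ν : ProbabilityMeasure X), (ν : Measure X) (s : Set X)ᶜ = 0 ∧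
      kantorovichDist μ ν ≤ ε := by
  have : Nonempty X := (μ : Measure X).nonempty_of_neZero
  obtain ⟨f, hf⟩ := exists_simpleFunc_dist_lt (X := X) hε
  refine ⟨f.range, pushforward f.measurable μ, ?_, kantorovichDist_le fun g hg => ?_⟩
  · rw [toMeasure_pushforward, Measure.map_apply f.measurable f.range.measurableSet.compl]
    convert measure_empty (μ := (μ : Measure X))
    ext x
    simp
  · rw [toMeasure_pushforward, integral_map f.measurable.aemeasurable
      hg.continuous.aestronglyMeasurable, ← integral_sub (integrable_of_continuous hg.continuous _),
      ← Real.norm_eq_abs]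
    · refine (norm_integral_le_of_norm_le_const (C := ε) (.of_forall fun x => ?_)).trans_eq
        (by simp)
      have h := hg.dist_le_mul x (f x)
      rw [NNReal.coe_one, one_mul, dist_eq_norm, dist_comm] at h
      exact h.trans (hf x).le
    · obtain ⟨C, hC⟩ := isCompact_univ.exists_bound_of_continuousOn hg.continuous.continuousOn
      exact Integrable.of_bound (hg.continuous.measurable.comp f.measurable).aestronglyMeasurable C
        (.of_forall fun x => hC _ trivial)

theorem kantorovichDist_pushforward_le {Y : Type v} [MetricSpace Y] [CompactSpace Y]
    [MeasurableSpace Y] [BorelSpace Y] {f : X → Y} (hf : LipschitzWith 1 f)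
    (μ ν : ProbabilityMeasure X) :
    kantorovichDist (pushforward hf.continuous.measurable μ)
      (pushforward hf.continuous.measurable ν) ≤ kantorovichDist μ ν := by
  refine kantorovichDist_le fun g hg => ?_
  rw [toMeasure_pushforward, toMeasure_pushforward,
    integral_map hf.continuous.aemeasurable hg.continuous.aestronglyMeasurable,
    integral_map hf.continuous.aemeasurable hg.continuous.aestronglyMeasurable]
  have hgf := hg.comp hf
  rw [one_mul] at hgf
  exact abs_integral_sub_le_kantorovichDist hgf μ ν

/-- The bijection of `Prob(X)` induced by an isometry of `X` onto itself. -/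
noncomputable def pushforwardIso (Φ : X ≃ᵢ X) : ProbabilityMeasure X ≃ ProbabilityMeasure X where
  toFun := pushforward Φ.continuous.measurable
  invFun := pushforward Φ.symm.continuous.measurable
  left_inv μ := by
    rw [pushforward_pushforward]
    refine ProbabilityMeasure.toMeasure_injective ?_
    rw [toMeasure_pushforward]
    convert Measure.map_id
    exact Φ.symm_comp_self
  right_inv μ := by
    rw [pushforward_pushforward]
    refine ProbabilityMeasure.toMeasure_injective ?_
    rw [toMeasure_pushforward]
    convert Measure.map_id
    exact Φ.self_comp_symm

theorem kantorovichDist_pushforwardIso (Φ : X ≃ᵢ X) (μ ν : ProbabilityMeasure X) :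
    kantorovichDist (pushforwardIso Φ μ) (pushforwardIso Φ ν) = kantorovichDist μ ν := by
  refine le_antisymm (kantorovichDist_pushforward_le Φ.isometry.lipschitz μ ν) ?_
  conv_lhs => rw [← (pushforwardIso Φ).symm_apply_apply μ, ← (pushforwardIso Φ).symm_apply_apply ν]
  exact kantorovichDist_pushforward_le Φ.symm.isometry.lipschitz _ _

/-- The fixed points of `S` are closed under convex combinations and so contain all finitely
supported measures, which are dense; an isometry fixing a dense set is the identity. -/
theorem eq_self_of_fixes_diracProba {S : ProbabilityMeasure X → ProbabilityMeasure X}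
    (hS : PreservesConvexComb S)
    (hdist : ∀ μ ν, kantorovichDist (S μ) (S ν) = kantorovichDist μ ν)
    (hdirac : ∀ x, S (diracProba x) = diracProba x) (μ : ProbabilityMeasure X) : S μ = μ := by
  refine eq_of_kantorovichDist_le_zero (le_of_forall_pos_le_add fun ε hε => ?_)
  obtain ⟨s, ν, hs, hν⟩ := exists_finite_support_kantorovichDist_le μ (half_pos hε)
  have hF : ConvexCombClosed {μ | S μ = μ} := by
    intro t μ hμ ν hν
    change S _ = _
    rw [hS, hμ, hν]
  have hfix : S ν = ν := hF.mem_of_finite_support hdirac s hs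
  have h1 := kantorovichDist_triangle (S μ) (S ν) μ
  rw [hdist, hfix, kantorovichDist_comm ν μ] at h1
  linarith

/-- `S` and its inverse preserve extremality, so they permute the Dirac measures and induce an
isometry `Φ` of `X`. Composing `S` with the inverse push-forward fixes every Dirac measure. -/
theorem exists_eq_pushforwardIso (S : ProbabilityMeasure X ≃ ProbabilityMeasure X)
    (hS : PreservesConvexComb S)
    (hdist : ∀ μ ν, kantorovichDist (S μ) (S ν) = kantorovichDist μ ν) :
    ∃ Φ : X ≃ᵢ X, ∀ μ, S μ = pushforwardIso Φ μ := by
  choose f hf using fun x => ((isExtremeProb_diracProba x).map hS).exists_eq_diracProba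
  choose g hg using fun x => ((isExtremeProb_diracProba x).map hS.symm).exists_eq_diracProba
  have hinj : Function.Injective (fun x : X => diracProba x) := injective_diracProba
  let Φ : X ≃ᵢ X :=
    { toFun := f
      invFun := g
      left_inv := fun x => hinj (by simp only [← hg, ← hf, Equiv.symm_apply_apply])
      right_inv := fun x => hinj (by simp only [← hg, ← hf, Equiv.apply_symm_apply])
      isometry_toFun := Isometry.of_dist_eq fun x y => by
        simp only [← kantorovichDist_diracProba, ← hf, hdist] }
  refine ⟨Φ, fun μ => ?_⟩
  have hΦ : PreservesConvexComb (pushforwardIso Φ) :=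
    preservesConvexComb_pushforward Φ.continuous.measurable
  rw [← Equiv.symm_apply_eq]
  refine eq_self_of_fixes_diracProba (S := fun μ => (pushforwardIso Φ).symm (S μ)) ?_ ?_ ?_ μ
  · intro t μ ν
    simp only [hS t μ ν, hΦ.symm t]
  · intro μ ν
    rw [← kantorovichDist_pushforwardIso Φ, Equiv.apply_symm_apply, Equiv.apply_symm_apply, hdist]
  · intro x
    rw [Equiv.symm_apply_eq, hf]
    exact (pushforward_diracProba Φ.continuous.measurable x).symm

theorem mem_fixSet_univ_iff {μ : ProbabilityMeasure X} :
    μ ∈ fixSet (Set.univ : Set (ProbabilityMeasure X)) ↔ ∀ Φ, pushforwardIso Φ μ = μ := by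
  constructor
  · rintro ⟨_, h⟩ Φ
    let e := Equiv.Set.univ (ProbabilityMeasure X)
    refine h ((e.trans (pushforwardIso Φ)).trans e.symm) ⟨fun μ ν => ?_, ?_⟩
    · exact kantorovichDist_pushforwardIso Φ μ.1 ν.1
    · rintro t μ ν ρ hρ
      change pushforwardIso Φ ρ.1 = _
      rw [hρ]
      exact preservesConvexComb_pushforward Φ.continuous.measurable t μ.1 ν.1
  · intro h
    refine ⟨trivial, fun T hT => ?_⟩
    let e := Equiv.Set.univ (ProbabilityMeasure X)
    obtain ⟨Φ, hΦ⟩ := exists_eq_pushforwardIso ((e.symm.trans T).trans e)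
      (fun t μ ν => hT.affine t ⟨μ, trivial⟩ ⟨ν, trivial⟩ ⟨_, trivial⟩ rfl)
      (fun μ ν => hT.isometry ⟨μ, trivial⟩ ⟨ν, trivial⟩)
    exact (hΦ μ).trans (h Φ)

end AffineIsometry

/-! ### The isometry group of a compact metric space as a compact topological group -/

section IsometryGroup

variable {X : Type u} [MetricSpace X]

/-- The topology of pointwise convergence on the isometry group. -/
instance isometryGroupTopology : TopologicalSpace (X ≃ᵢ X) :=
  TopologicalSpace.induced (fun Φ x => Φ x) Pi.topologicalSpace

theorem continuous_eval (x : X) : Continuous fun Φ : X ≃ᵢ X => Φ x :=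
  (continuous_apply x).comp continuous_induced_dom

/-- Isometries are equicontinuous, which upgrades pointwise to joint continuity. -/
theorem continuous_eval_uncurry : Continuous fun p : (X ≃ᵢ X) × X => p.1 p.2 := by
  rw [continuous_iff_continuousAt]
  rintro ⟨Φ, x⟩
  rw [ContinuousAt, tendsto_iff_dist_tendsto_zero]
  have h1 : Tendsto (fun p : (X ≃ᵢ X) × X => dist p.2 x + dist (p.1 x) (Φ x)) (𝓝 (Φ, x))
      (𝓝 (dist x x + dist (Φ x) (Φ x))) := by
    exact (((continuous_snd (X := X ≃ᵢ X)).dist continuous_const).add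
      (((continuous_eval x).comp continuous_fst).dist continuous_const)).tendsto (Φ, x)
  rw [dist_self, dist_self, add_zero] at h1
  refine squeeze_zero (fun _ => dist_nonneg) (fun p => ?_) h1
  rw [← p.1.dist_eq p.2 x]
  exact dist_triangle _ _ _

theorem continuous_isometryGroup_iff {Z : Type*} [TopologicalSpace Z] {F : Z → X ≃ᵢ X} :
    Continuous F ↔ ∀ x, Continuous fun z => F z x := by
  rw [continuous_induced_rng, continuous_pi_iff]
  rfl

instance : IsTopologicalGroup (X ≃ᵢ X) where
  continuous_mul := continuous_isometryGroup_iff.2 fun x =>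
    continuous_eval_uncurry.comp (continuous_fst.prodMk ((continuous_eval x).comp continuous_snd))
  continuous_inv := continuous_isometryGroup_iff.2 fun x => by
    rw [continuous_iff_continuousAt]
    intro Φ
    rw [ContinuousAt, tendsto_iff_dist_tendsto_zero]
    have h1 : Tendsto (fun Ψ : X ≃ᵢ X => dist x (Ψ (Φ⁻¹ x))) (𝓝 Φ)
        (𝓝 (dist x (Φ (Φ⁻¹ x)))) :=
      (tendsto_const_nhds).dist ((continuous_eval (Φ⁻¹ x)).tendsto Φ)
    rw [IsometryEquiv.apply_inv_self, dist_self] at h1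
    refine h1.congr fun Ψ => ?_
    rw [← Ψ.dist_eq (Ψ⁻¹ x), IsometryEquiv.apply_inv_self]

/-- Pointwise ultrafilter limits of the maps and of their inverses exist in `X`, and remain
isometric and mutually inverse. -/
instance [CompactSpace X] : CompactSpace (X ≃ᵢ X) := by
  refine ⟨isCompact_iff_ultrafilter_le_nhds.2 fun U _ => ?_⟩
  have hlim : ∀ F : (X ≃ᵢ X) → X, ∃ l, Tendsto F U (𝓝 l) := by
    intro F
    obtain ⟨l, -, hl⟩ := isCompact_univ.ultrafilter_le_nhds (U.map F) (by simp)
    exact ⟨l, hl⟩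
  choose f hf using fun z => hlim fun Φ => Φ z
  choose g hg using fun z => hlim fun Φ => Φ⁻¹ z
  have hgf : ∀ z, g (f z) = z := by
    intro z
    refine tendsto_nhds_unique (hg (f z)) (tendsto_iff_dist_tendsto_zero.2 ?_)
    have h2 := (tendsto_const_nhds (x := f z)).dist (hf z)
    rw [dist_self] at h2
    refine h2.congr fun Φ => ?_
    rw [← Φ.dist_eq (Φ⁻¹ (f z)), IsometryEquiv.apply_inv_self]
  have hfg : ∀ z, f (g z) = z := by
    intro z
    refine tendsto_nhds_unique (hf (g z)) (tendsto_iff_dist_tendsto_zero.2 ?_)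
    have h2 := (tendsto_const_nhds (x := g z)).dist (hg z)
    rw [dist_self] at h2
    refine h2.congr fun Φ => ?_
    rw [← Φ.dist_eq (g z), IsometryEquiv.apply_inv_self]
  have hiso : Isometry f := by
    refine Isometry.of_dist_eq fun z w => ?_
    have h1 := (hf z).dist (hf w)
    simp only [IsometryEquiv.dist_eq] at h1
    exact tendsto_nhds_unique h1 tendsto_const_nhds
  refine ⟨⟨⟨f, g, hgf, hfg⟩, hiso⟩, trivial, ?_⟩
  rw [nhds_induced, ← tendsto_iff_comap, tendsto_pi_nhds]
  exact hf

/-- The Borel σ-algebra of the isometry group. -/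
instance isometryGroupMeasurableSpace : MeasurableSpace (X ≃ᵢ X) := borel _

instance : BorelSpace (X ≃ᵢ X) := ⟨rfl⟩

theorem measurable_eval [MeasurableSpace X] [BorelSpace X] (x : X) : Measurable fun Φ : X ≃ᵢ X => Φ x :=
  (continuous_eval x).measurable

variable [CompactSpace X]

variable (X) in
/-- The normalized Haar measure of the isometry group. -/
noncomputable def isometryHaar : Measure (X ≃ᵢ X) := Measure.haarMeasure ⊤

instance : IsProbabilityMeasure (isometryHaar X) := ⟨Measure.haarMeasure_self⟩

instance : (isometryHaar X).IsHaarMeasure := Measure.isHaarMeasure_haarMeasure _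

/-- A right translate is again a Haar probability measure, hence the same one: compact groups are
unimodular. -/
instance : (isometryHaar X).IsMulRightInvariant := by
  refine ⟨fun Ψ => ?_⟩
  have : IsProbabilityMeasure ((isometryHaar X).map (· * Ψ)) :=
    Measure.isProbabilityMeasure_map (measurable_mul_const Ψ).aemeasurable
  exact Measure.isHaarMeasure_eq_of_isProbabilityMeasure _ _

/-! ### Orbit measures and averages -/

variable [MeasurableSpace X] [BorelSpace X]

/-- The image of the Haar measure on the orbit of a point. -/
noncomputable def orbitMeasure (x : X) : ProbabilityMeasure X :=
  ⟨(isometryHaar X).map fun Φ => Φ x,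
    Measure.isProbabilityMeasure_map (measurable_eval x).aemeasurable⟩

theorem toMeasure_orbitMeasure (x : X) :
    (orbitMeasure x : Measure X) = (isometryHaar X).map fun Φ => Φ x := rfl

/-- Right invariance makes the orbit measure independent of the base point; left invariance, used
next, makes it an invariant measure on `X`. -/
theorem orbitMeasure_apply_isometry (Ψ : X ≃ᵢ X) (x : X) :
    orbitMeasure (Ψ x) = orbitMeasure x := by
  apply ProbabilityMeasure.toMeasure_injective
  rw [toMeasure_orbitMeasure, toMeasure_orbitMeasure]
  conv_rhs => rw [← map_mul_right_eq_self (isometryHaar X) Ψ,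
    Measure.map_map (measurable_eval x) (measurable_mul_const Ψ)]
  rfl

theorem pushforwardIso_orbitMeasure (Ψ : X ≃ᵢ X) (x : X) :
    pushforwardIso Ψ (orbitMeasure x) = orbitMeasure x := by
  apply ProbabilityMeasure.toMeasure_injective
  change ((isometryHaar X).map fun Φ => Φ x).map Ψ = (isometryHaar X).map fun Φ => Φ x
  conv_rhs => rw [← map_mul_left_eq_self (isometryHaar X) Ψ,
    Measure.map_map (measurable_eval x) (measurable_const_mul Ψ)]
  rw [Measure.map_map Ψ.continuous.measurable (measurable_eval x)]
  rfl

theorem measurable_orbitMeasure : Measurable fun x : X => (orbitMeasure x : Measure X) := by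
  refine Measure.measurable_of_measurable_coe _ fun s hs => ?_
  have h : ∀ x : X, (orbitMeasure x : Measure X) s =
      isometryHaar X ((fun Φ => (Φ, x)) ⁻¹' ((fun p : (X ≃ᵢ X) × X => p.1 p.2) ⁻¹' s)) :=
    fun x => Measure.map_apply (measurable_eval x) hs
  simp only [h]
  exact measurable_measure_prodMk_right (continuous_eval_uncurry.measurable hs)

/-- The orbit measure as a function of the orbit. -/
noncomputable def orbitKernel (a : OrbitSpace X) : ProbabilityMeasure X :=
  Quotient.lift (s := isoSetoid X) orbitMeasure
    (by rintro x _ ⟨Ψ, rfl⟩; exact (orbitMeasure_apply_isometry Ψ x).symm) a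

theorem orbitKernel_proj (x : X) : orbitKernel (proj x) = orbitMeasure x := rfl

variable [MeasurableSpace (OrbitSpace X)] [BorelSpace (OrbitSpace X)]

theorem measurable_proj : Measurable (proj : X → OrbitSpace X) :=
  lipschitzWith_proj.continuous.measurable

/-- A measurable surjection from a standard Borel space detects Borel sets of its target, so
measurability descends from `X` to the orbit space. -/
theorem measurable_orbitKernel :
    Measurable fun a : OrbitSpace X => (orbitKernel a : Measure X) :=
  (measurable_proj.measurable_comp_iff_of_surjective proj_surjective).1 measurable_orbitMeasure

/-- The invariant measure on `X` with a given image on the orbit space. -/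
noncomputable def invariantLift (ν : ProbabilityMeasure (OrbitSpace X)) : ProbabilityMeasure X :=
  ⟨(ν : Measure (OrbitSpace X)).bind fun a => (orbitKernel a : Measure X),
    isProbabilityMeasure_bind measurable_orbitKernel.aemeasurable
      (.of_forall fun a => (orbitKernel a).2)⟩

theorem invariantLift_apply (ν : ProbabilityMeasure (OrbitSpace X)) {s : Set X}
    (hs : MeasurableSet s) : (invariantLift ν : Measure X) s =
      ∫⁻ a, (orbitKernel a : Measure X) s ∂(ν : Measure (OrbitSpace X)) :=
  Measure.bind_apply hs measurable_orbitKernel.aemeasurable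

theorem invariantLift_mem_fixSet (ν : ProbabilityMeasure (OrbitSpace X)) :
    invariantLift ν ∈ fixSet (Set.univ : Set (ProbabilityMeasure X)) := by
  refine mem_fixSet_univ_iff.2 fun Ψ => ProbabilityMeasure.toMeasure_injective ?_
  refine Measure.ext fun s hs => ?_
  have hΨ : Measurable Ψ := Ψ.continuous.measurable
  change (invariantLift ν : Measure X).map Ψ s = _
  rw [Measure.map_apply hΨ hs, invariantLift_apply ν (hΨ hs), invariantLift_apply ν hs]
  refine lintegral_congr fun a => ?_
  obtain ⟨x, rfl⟩ := proj_surjective a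
  rw [orbitKernel_proj]
  conv_rhs => rw [← pushforwardIso_orbitMeasure Ψ x]
  exact (Measure.map_apply hΨ hs).symm

theorem pushforward_proj_invariantLift (ν : ProbabilityMeasure (OrbitSpace X)) :
    pushforward measurable_proj (invariantLift ν) = ν := by
  refine ProbabilityMeasure.toMeasure_injective (Measure.ext fun s hs => ?_)
  rw [toMeasure_pushforward, Measure.map_apply measurable_proj hs,
    invariantLift_apply ν (measurable_proj hs), ← lintegral_indicator_one hs]
  refine lintegral_congr fun a => ?_
  obtain ⟨x, rfl⟩ := proj_surjective a
  rw [orbitKernel_proj, toMeasure_orbitMeasure,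
    Measure.map_apply (measurable_eval x) (measurable_proj hs)]
  have h : ∀ Φ : X ≃ᵢ X, proj (Φ x) = proj x := fun Φ => (proj_eq_iff.2 ⟨Φ, rfl⟩).symm
  by_cases hx : proj x ∈ s <;> simp [Set.preimage, h, hx]

/-- Only `≥` needs invariance. Averaging a nonexpansive `f` over the group yields a function on
orbits which has the same integrals against invariant measures and is still nonexpansive. -/
theorem kantorovichDist_pushforward_proj {μ ν : ProbabilityMeasure X}
    (hμ : ∀ Φ, pushforwardIso Φ μ = μ) (hν : ∀ Φ, pushforwardIso Φ ν = ν) :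
    kantorovichDist (pushforward measurable_proj μ) (pushforward measurable_proj ν) =
      kantorovichDist μ ν := by
  refine le_antisymm (kantorovichDist_pushforward_le lipschitzWith_proj μ ν)
    (kantorovichDist_le fun f hf => ?_)
  let g : OrbitSpace X → ℝ := fun a => ∫ y, f y ∂(orbitKernel a : Measure X)
  have hg_proj : ∀ x, g (proj x) = ∫ Φ : X ≃ᵢ X, f (Φ x) ∂(isometryHaar X) := fun x =>
    integral_map (measurable_eval x).aemeasurable hf.continuous.aestronglyMeasurable
  have hint : ∀ x, Integrable (fun Φ : X ≃ᵢ X => f (Φ x)) (isometryHaar X) := fun x =>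
    (hf.continuous.comp (continuous_eval x)).integrable_of_hasCompactSupport
      (HasCompactSupport.of_compactSpace _)
  have hg : LipschitzWith 1 g := by
    refine LipschitzWith.of_dist_le_mul fun a b => ?_
    rw [NNReal.coe_one, one_mul]
    -- The maximality of the orbit metric enters here: it suffices that `|g a - g b|` is a
    -- pseudometric for which the projection is nonexpansive.
    refine le_orbitDist (ρ := fun a b => dist (g a) (g b))
      ⟨fun _ => dist_self _, fun _ _ => dist_comm _ _, fun _ _ _ => dist_triangle _ _ _,
        fun x y => ?_⟩ a b
    rw [hg_proj, hg_proj, dist_eq_norm, ← integral_sub (hint x) (hint y)]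
    refine (norm_integral_le_of_norm_le_const (C := dist x y)
      (.of_forall fun Φ => ?_)).trans_eq (by simp)
    have h := hf.dist_le_mul (Φ x) (Φ y)
    rwa [NNReal.coe_one, one_mul, dist_eq_norm, Φ.dist_eq] at h
  have key : ∀ ρ : ProbabilityMeasure X, (∀ Φ, pushforwardIso Φ ρ = ρ) →
      ∫ a, g a ∂(pushforward measurable_proj ρ : Measure (OrbitSpace X)) =
        ∫ x, f x ∂(ρ : Measure X) := by
    intro ρ hρ
    rw [toMeasure_pushforward, integral_map measurable_proj.aemeasurable
      hg.continuous.aestronglyMeasurable]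
    simp only [hg_proj]
    -- After Fubini the inner integral no longer depends on `Φ`, by invariance of `ρ`.
    rw [integral_integral_swap_of_hasCompactSupport
      (f := fun (x : X) (Φ : X ≃ᵢ X) => f (Φ x))
      (hf.continuous.comp (continuous_eval_uncurry.comp continuous_swap))
      (HasCompactSupport.of_compactSpace _)]
    have h : ∀ Φ : X ≃ᵢ X, ∫ x, f (Φ x) ∂(ρ : Measure X) = ∫ x, f x ∂(ρ : Measure X) := by
      intro Φ
      conv_rhs => rw [← hρ Φ]
      exact (integral_map Φ.continuous.aemeasurable
        hf.continuous.aestronglyMeasurable).symm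
    simp [h]
  rw [← key μ hμ, ← key ν hν]
  exact abs_integral_sub_le_kantorovichDist hg _ _

theorem bijOn_pushforward_proj :
    Set.BijOn (pushforward (measurable_proj (X := X))) (fixSet Set.univ) Set.univ := by
  refine ⟨fun _ _ => trivial, fun μ hμ ν hν h => ?_, fun ν _ =>
    ⟨invariantLift ν, invariantLift_mem_fixSet ν, pushforward_proj_invariantLift ν⟩⟩
  apply eq_of_kantorovichDist_le_zero
  rw [← kantorovichDist_pushforward_proj (mem_fixSet_univ_iff.1 hμ) (mem_fixSet_univ_iff.1 hν), h]
  exact kantorovichDist_le fun f _ => by simp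

end IsometryGroup

/-! ### Transport of fixed point sets -/

section Transport

variable {X : Type u} {Y : Type v} [MetricSpace X] [MeasurableSpace X]
  [MetricSpace Y] [MeasurableSpace Y]

/-- Affine isometries of `L` are conjugated by `e` to those of `K`. Affinity is a relation among
members, needed in both directions, so neither set has to be convex. -/
theorem mem_fixSet_of_equiv {K : Set (ProbabilityMeasure X)} {L : Set (ProbabilityMeasure Y)}
    (e : K ≃ L) (hdist : ∀ μ ν : K, kantorovichDist (e μ).1 (e ν).1 = kantorovichDist μ.1 ν.1)
    (haff : ∀ (t : I) (μ ν ρ : K),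
      (e ρ).1 = convexComb t (e μ).1 (e ν).1 ↔ ρ.1 = convexComb t μ.1 ν.1)
    {μ : K} (hμ : μ.1 ∈ fixSet K) : (e μ).1 ∈ fixSet L := by
  refine ⟨(e μ).2, fun T hT => ?_⟩
  obtain ⟨_, h⟩ := hμ
  have h1 := h ((e.trans T).trans e.symm) ⟨fun μ ν => ?_, fun t μ ν ρ hρ => ?_⟩
  · have h2 : e.symm (T (e μ)) = μ := Subtype.ext h1
    rw [Equiv.symm_apply_eq] at h2
    exact congrArg Subtype.val h2
  · rw [← hdist]
    simp only [Equiv.trans_apply, Equiv.apply_symm_apply]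
    rw [hT.isometry]
    exact hdist μ ν
  · rw [← haff]
    simp only [Equiv.trans_apply, Equiv.apply_symm_apply]
    exact hT.affine t _ _ _ ((haff t μ ν ρ).2 hρ)

theorem bijOn_fixSet {P : ProbabilityMeasure X → ProbabilityMeasure Y}
    (hP : PreservesConvexComb P) {K : Set (ProbabilityMeasure X)}
    {L : Set (ProbabilityMeasure Y)} (hK : ConvexCombClosed K) (hbij : Set.BijOn P K L)
    (hdist : ∀ μ ∈ K, ∀ ν ∈ K, kantorovichDist (P μ) (P ν) = kantorovichDist μ ν) :
    Set.BijOn P (fixSet K) (fixSet L) := by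
  let e : K ≃ L := hbij.equiv P
  have he : ∀ μ : K, (e μ).1 = P μ.1 := fun _ => rfl
  have hdist' : ∀ μ ν : K, kantorovichDist (e μ).1 (e ν).1 = kantorovichDist μ.1 ν.1 :=
    fun μ ν => hdist μ.1 μ.2 ν.1 ν.2
  have haff : ∀ (t : I) (μ ν ρ : K),
      (e ρ).1 = convexComb t (e μ).1 (e ν).1 ↔ ρ.1 = convexComb t μ.1 ν.1 := by
    intro t μ ν ρ
    rw [he, he, he, ← hP]
    exact hbij.injOn.eq_iff ρ.2 (hK t μ.1 μ.2 ν.1 ν.2)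
  refine ⟨?_, hbij.injOn.mono fun μ hμ => hμ.1, ?_⟩
  · rintro μ hμ
    exact mem_fixSet_of_equiv e hdist' haff (μ := ⟨μ, hμ.1⟩) hμ
  · rintro ν hν
    obtain ⟨μ, hμ⟩ := e.surjective ⟨ν, hν.1⟩
    have hνμ : e.symm ⟨ν, hν.1⟩ = μ := by rw [← hμ, Equiv.symm_apply_apply]
    refine ⟨μ.1, ?_, congrArg Subtype.val hμ⟩
    rw [← hνμ]
    refine mem_fixSet_of_equiv e.symm (fun μ ν => ?_) (fun t μ ν ρ => ?_)
      (μ := ⟨ν, hν.1⟩) hν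
    · rw [← hdist', Equiv.apply_symm_apply, Equiv.apply_symm_apply]
    · rw [← haff, Equiv.apply_symm_apply, Equiv.apply_symm_apply, Equiv.apply_symm_apply]

theorem ConvexCombClosed.fixSet {K : Set (ProbabilityMeasure X)} (hK : ConvexCombClosed K) :
    ConvexCombClosed (fixSet K) := by
  rintro t μ ⟨hμ, hμT⟩ ν ⟨hν, hνT⟩
  refine ⟨hK t μ hμ ν hν, fun T hT => ?_⟩
  rw [hT.affine t ⟨μ, hμ⟩ ⟨ν, hν⟩ _ rfl, hμT T hT, hνT T hT]

theorem ConvexCombClosed.iterFix {K : Set (ProbabilityMeasure X)} (hK : ConvexCombClosed K)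
    (n : ℕ) : ConvexCombClosed (iterFix K n) := by
  induction n with
  | zero => exact hK
  | succ n ih => exact ih.fixSet

theorem antitone_iterFix (K : Set (ProbabilityMeasure X)) : Antitone (iterFix K) :=
  antitone_nat_of_succ_le fun _ _ hμ => hμ.1

variable [CompactSpace X] [BorelSpace X]

theorem KantorovichClosed.fixSet {K : Set (ProbabilityMeasure X)} (hK : KantorovichClosed K) :
    KantorovichClosed (fixSet K) := by
  intro μ hμ
  have hμK : μ ∈ K := hK μ fun ε hε => by
    obtain ⟨ν, hν, h⟩ := hμ ε hε
    exact ⟨ν, hν.1, h⟩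
  refine ⟨hμK, fun T hT => eq_of_kantorovichDist_le_zero (le_of_forall_pos_le_add fun ε hε => ?_)⟩
  obtain ⟨ν, ⟨hνK, hν⟩, h⟩ := hμ (ε / 2) (half_pos hε)
  have h1 := hT.isometry ⟨μ, hμK⟩ ⟨ν, hνK⟩
  rw [hν T hT] at h1
  have h2 := kantorovichDist_triangle (T ⟨μ, hμK⟩).1 ν μ
  rw [h1, kantorovichDist_comm ν μ] at h2
  dsimp only at h2
  linarith

theorem KantorovichClosed.iterFix {K : Set (ProbabilityMeasure X)} (hK : KantorovichClosed K)
    (n : ℕ) : KantorovichClosed (iterFix K n) := by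
  induction n with
  | zero => exact hK
  | succ n ih => exact ih.fixSet

/-- An ultrafilter limit exists by weak compactness. The tail of the sequence lies in each `Fixᵐ`,
which is closed, so the limit lies in all of them. -/
theorem exists_mem_centralSet_tendsto {μs : ℕ → ProbabilityMeasure X}
    (hμs : ∀ n, μs n ∈ iterFix Set.univ n) {U : Ultrafilter ℕ} (hU : (U : Filter ℕ) ≤ atTop) :
    ∃ μ ∈ centralSet X, Tendsto (fun n => kantorovichDist (μs n) μ) U (𝓝 0) := by
  obtain ⟨μ, -, hμ⟩ := isCompact_univ.ultrafilter_le_nhds (U.map μs) (by simp)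
  have hlim := tendsto_kantorovichDist (F := (U : Filter ℕ)) (μs := μs) hμ
  refine ⟨μ, Set.mem_iInter.2 fun m => ?_, hlim⟩
  have hclosed : KantorovichClosed (Set.univ : Set (ProbabilityMeasure X)) := fun _ _ => trivial
  refine hclosed.iterFix m μ fun ε hε => ?_
  obtain ⟨n, hn, hmn⟩ := ((hlim.eventually_lt_const hε).and (hU (eventually_ge_atTop m))).exists
  exact ⟨μs n, antitone_iterFix _ hmn (hμs n), by rwa [kantorovichDist_comm]⟩

end Transport

/-! ### The central measures and the iterated orbit spaces -/

section Main

variable (X : Type u) [MetricSpace X] [CompactSpace X]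

theorem nonempty_iterOrbitSpace [Nonempty X] (n : ℕ) : Nonempty (iterOrbitSpace X n).carrier := by
  induction n with
  | zero => assumption
  | succ n ih => exact ih.map proj

variable [mX : MeasurableSpace X] [hX : BorelSpace X]

/-- The iterated orbit spaces carry no chosen σ-algebra, so the claim covers every Borel structure;
any two coincide. -/
theorem exists_bijOn_iterFix (n : ℕ) :
    ∀ [MeasurableSpace (iterOrbitSpace X n).carrier] [BorelSpace (iterOrbitSpace X n).carrier],
      ∃ P : ProbabilityMeasure X → ProbabilityMeasure (iterOrbitSpace X n).carrier,
        PreservesConvexComb P ∧ Set.BijOn P (iterFix Set.univ n) Set.univ ∧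
        ∀ μ ∈ iterFix Set.univ n, ∀ ν ∈ iterFix Set.univ n,
          kantorovichDist (P μ) (P ν) = kantorovichDist μ ν := by
  induction n with
  | zero =>
    intro m hm
    have h : mX = m := hX.measurable_eq.trans hm.measurable_eq.symm
    subst h
    exact ⟨id, fun _ _ _ => rfl, Set.bijOn_id _, fun _ _ _ _ => rfl⟩
  | succ n ih =>
    intro m hm
    let _ : MeasurableSpace (iterOrbitSpace X n).carrier := borel _
    have _ : BorelSpace (iterOrbitSpace X n).carrier := ⟨rfl⟩
    let _ : MeasurableSpace (OrbitSpace (iterOrbitSpace X n).carrier) := m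
    have _ : BorelSpace (OrbitSpace (iterOrbitSpace X n).carrier) := hm
    obtain ⟨P, hP, hbij, hdist⟩ := ih
    have huniv : ConvexCombClosed (Set.univ : Set (ProbabilityMeasure X)) :=
      fun _ _ _ _ _ => trivial
    have hfix := bijOn_fixSet hP (huniv.iterFix n) hbij hdist
    refine ⟨fun μ => pushforward measurable_proj (P μ), fun t μ ν => ?_,
      bijOn_pushforward_proj.comp hfix, fun μ hμ ν hν => ?_⟩
    · exact (congrArg (pushforward measurable_proj) (hP t μ ν)).trans
        (preservesConvexComb_pushforward measurable_proj t (P μ) (P ν))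
    · rw [← hdist μ hμ.1 ν hν.1]
      exact kantorovichDist_pushforward_proj (mem_fixSet_univ_iff.1 (hfix.mapsTo hμ))
        (mem_fixSet_univ_iff.1 (hfix.mapsTo hν))

theorem kantorovichDist_le_diam_iterOrbitSpace (n : ℕ) {μ ν : ProbabilityMeasure X}
    (hμ : μ ∈ iterFix Set.univ n) (hν : ν ∈ iterFix Set.univ n) :
    kantorovichDist μ ν ≤ Metric.diam (Set.univ : Set (iterOrbitSpace X n).carrier) := by
  let _ : MeasurableSpace (iterOrbitSpace X n).carrier := borel _
  have _ : BorelSpace (iterOrbitSpace X n).carrier := ⟨rfl⟩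
  obtain ⟨P, -, -, hdist⟩ := exists_bijOn_iterFix X n
  rw [← hdist μ hμ ν hν]
  exact kantorovichDist_le_diam _ _

/-- The diameter is attained at two points; the witnesses correspond to their Dirac measures. -/
theorem exists_diam_iterOrbitSpace_le [Nonempty X] (n : ℕ) :
    ∃ μ ∈ iterFix (Set.univ : Set (ProbabilityMeasure X)) n, ∃ ν ∈ iterFix Set.univ n,
      Metric.diam (Set.univ : Set (iterOrbitSpace X n).carrier) ≤ kantorovichDist μ ν := by
  let _ : MeasurableSpace (iterOrbitSpace X n).carrier := borel _
  have _ : BorelSpace (iterOrbitSpace X n).carrier := ⟨rfl⟩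
  have := nonempty_iterOrbitSpace X n
  obtain ⟨P, -, hbij, hdist⟩ := exists_bijOn_iterFix X n
  obtain ⟨⟨a, b⟩, -, hab⟩ := isCompact_univ.exists_isMaxOn Set.univ_nonempty
    (continuous_dist (α := (iterOrbitSpace X n).carrier)).continuousOn
  obtain ⟨μ, hμ, hμa⟩ := hbij.surjOn (Set.mem_univ (diracProba a))
  obtain ⟨ν, hν, hνb⟩ := hbij.surjOn (Set.mem_univ (diracProba b))
  refine ⟨μ, hμ, ν, hν, ?_⟩
  rw [← hdist μ hμ ν hν, hμa, hνb, kantorovichDist_diracProba]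
  exact Metric.diam_le_of_forall_dist_le dist_nonneg fun x _ y _ => hab (Set.mem_univ (x, y))

theorem subsingleton_centralSet (h : QuasiNilpotent X) {μ ν : ProbabilityMeasure X}
    (hμ : μ ∈ centralSet X) (hν : ν ∈ centralSet X) : μ = ν :=
  eq_of_kantorovichDist_le_zero <| ge_of_tendsto' h fun n =>
    kantorovichDist_le_diam_iterOrbitSpace X n (Set.mem_iInter.1 hμ n) (Set.mem_iInter.1 hν n)

theorem nonempty_centralSet [Nonempty X] : (centralSet X).Nonempty := by
  choose μs hμs _ _ _ using exists_diam_iterOrbitSpace_le X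
  obtain ⟨μ, hμ, -⟩ := exists_mem_centralSet_tendsto hμs (Ultrafilter.of_le (atTop : Filter ℕ))
  exact ⟨μ, hμ⟩

theorem quasiNilpotent_of_existsUnique [Nonempty X] (h : ∃! μ, μ ∈ centralSet X) :
    QuasiNilpotent X := by
  obtain ⟨μ, -, hunique⟩ := h
  choose μs hμs νs hνs hdiam using exists_diam_iterOrbitSpace_le X
  have hlim : ∀ ρs : ℕ → ProbabilityMeasure X, (∀ n, ρs n ∈ iterFix Set.univ n) →
      Tendsto (fun n => kantorovichDist (ρs n) μ) atTop (𝓝 0) := by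
    intro ρs hρs
    -- Along every ultrafilter the limit is a central measure, hence `μ`; this gives convergence of
    -- the whole sequence.
    rw [tendsto_iff_ultrafilter]
    intro U hU
    obtain ⟨ρ, hρ, hρlim⟩ := exists_mem_centralSet_tendsto hρs hU
    rwa [hunique ρ hρ] at hρlim
  have h0 := (hlim μs hμs).add (hlim νs hνs)
  rw [add_zero] at h0
  refine squeeze_zero (fun _ => Metric.diam_nonneg) (fun n => (hdiam n).trans ?_) h0
  rw [kantorovichDist_comm (νs n)]
  exact kantorovichDist_triangle _ _ _

end Main

end CentralMeasure

theorem mainTheorem7 (X : Type u) [MetricSpace X] [CompactSpace X] [Nonempty X]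
    [MeasurableSpace X] [BorelSpace X] :
    (∃! μ : MeasureTheory.ProbabilityMeasure X, μ ∈ CentralMeasure.centralSet X) ↔
      CentralMeasure.QuasiNilpotent X := by
  refine ⟨CentralMeasure.quasiNilpotent_of_existsUnique X, fun h => ?_⟩
  obtain ⟨μ, hμ⟩ := CentralMeasure.nonempty_centralSet X
  exact ⟨μ, hμ, fun ν hν => CentralMeasure.subsingleton_centralSet X h hν hμ⟩
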